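/- Let $p$ be a prime, let $q$ be a square power of $p$, and let $\mathbb F_q$ be the field with $q$ elements. A point set $S\subseteq \mathrm{PG}(2,q)$ is called $1$-saturating if every point of $\mathrm{PG}(2,q)$ (in homogeneous coordinates) is a linear combination of at most two points of $S$, and this fails with "two" replaced by "one" (that is, $S$ is not the whole plane). A point set of a projective plane is a double blocking set if every line of the plane contains at least two of its points. Write $\mathrm{PG}(2,\sqrt q)\subset \mathrm{PG}(2,q)$ for the Baer subplane of points having homogeneous coordinates in the subfield $\mathbb F_{\sqrt q}$ of $\mathbb F_q$, and, when $\sqrt q$ is not prime, write $\phi(\sqrt q)$ for the order of the largest proper subfield of $\mathbb F_{\sqrt q}$. Then in $\mathrm{PG}(2,q)$ there exist $1$-saturating sets, each of which is moreover a double blocking set of the Baer subplane $\mathrm{PG}(2,\sqrt q)$, of exactly the following sizes: (iv) $2\sqrt q+2\sqrt[3]{q}+2\sqrt[6]{q}+2$, if $q=p^{6h}$ with $h\ge 1$ and $p^h\equiv 2 \pmod 7$; (v) $2\sqrt q+2\,\dfrac{\sqrt q-1}{\phi(\sqrt q)-1}$, if $q=p^{2h}$ with $h\ge2$ and $p\ge3$;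 (vi) $2\sqrt q+2\,\dfrac{\sqrt q}{p}+2$, if $q=p^{2h}$ with $h\ge2$ and $p\ge7$. -/

import Mathlib

open scoped LinearAlgebra.Projectivization

/-- A point set `S` of `PG(V)` covers it with parameter `ρ`: every point, in homogeneous
coordinates, is a linear combination of at most `ρ + 1` points of `S`. -/
def CoversWith {F V : Type*} [Field F] [AddCommGroup V] [Module F V]
    (ρ : ℕ) (S : Set (ℙ F V)) : Prop :=
  ∀ A : ℙ F V, ∃ T : Set (ℙ F V), T ⊆ S ∧ T.encard ≤ ((ρ + 1 : ℕ) : ℕ∞) ∧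
    A.submodule ≤ ⨆ P ∈ T, P.submodule

/-- `S` is `ρ`-saturating: it covers with parameter `ρ`, and `ρ` is the smallest such value. -/
def IsSaturating {F V : Type*} [Field F] [AddCommGroup V] [Module F V]
    (ρ : ℕ) (S : Set (ℙ F V)) : Prop :=
  IsLeast {k : ℕ | CoversWith k S} ρ

/-- A double blocking set of the projective plane `PG(2, K)`: every line (two-dimensional subspace
of `K³`) contains at least two points of `B`. -/
def IsDoubleBlocking {K : Type*} [Field K] (B : Set (ℙ K (Fin 3 → K))) : Prop :=
  ∀ W : Submodule K (Fin 3 → K), Module.finrank K W = 2 →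
    2 ≤ {P : ℙ K (Fin 3 → K) | P ∈ B ∧ P.submodule ≤ W}.encard

/-- The coordinatewise inclusion `K³ → F³` for a subfield `K` of `F`. -/
def coordIncl {F : Type*} [Field F] (K : Subfield F) :
    (Fin 3 → K) →ₛₗ[K.subtype] (Fin 3 → F) where
  toFun v := fun i => (v i : F)
  map_add' _ _ := rfl
  map_smul' _ _ := rfl

theorem coordIncl_injective {F : Type*} [Field F] (K : Subfield F) :
    Function.Injective (coordIncl K) := by
  intro v w h
  funext i
  exact Subtype.ext (congrFun h i)

/-- The inclusion of `PG(2, K)` into `PG(2, F)` as a subplane: the points which have homogeneous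
coordinates in the subfield `K`. It is a Baer subplane if `|F| = |K|²`. -/
def subplaneIncl {F : Type*} [Field F] (K : Subfield F) :
    ℙ K (Fin 3 → K) → ℙ F (Fin 3 → F) :=
  Projectivization.map (coordIncl K) (coordIncl_injective K)

/-- The order `φ` of the largest proper subfield of a finite field `K` (used only for fields
which have a proper subfield, that is, fields of non-prime order). -/
noncomputable def largestProperSubfieldOrder (K : Type*) [Field K] : ℕ :=
  sSup {n : ℕ | ∃ L : Subfield K, L ≠ ⊤ ∧ Nat.card L = n}

/-! Let `K` be the subfield of index two in `F`. Writing the coordinates of a point of `PG(2, F)` in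
a `K`-basis of `F` exhibits it as a combination of two points of `PG(2, K)`, so it lies on the
extension of a line of the Baer subplane. A double blocking set `B` of the subplane has two points
on that line, and they span the given point; hence `B` is `1`-saturating in `PG(2, F)`.

Double blocking sets are obtained as the union of a blocking set and a disjoint image of it under a
collineation. The blocking sets are of Rédei type: the graph of an additive function `f : K → K`
together with the directions it determines. For a proper subfield `k` of `K` of order `r`, there
are `(|K| - 1) / (r - 1)` directions if `f` is the Frobenius map `x ↦ x ^ r`, and `|K| / r + 1`
if `f` is the trace to `k`. In both cases disjointness amounts to finding a value omitted by a
certain map: for the Frobenius map it exists by Hermite's criterion for permutation polynomials,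
and for the trace because a suitable `δ` makes `a ↦ Tr(δ / (a - θ)) - a` non-injective on the
finite set `k`.
-/

section LinearAlgebra

theorem submodule_le_comap_submodule_map {K L V W : Type*} [Field K] [Field L] [AddCommGroup V]
    [Module K V] [AddCommGroup W] [Module L W] {σ : K →+* L} (f : V →ₛₗ[σ] W)
    (hf : Function.Injective f) (P : ℙ K V) :
    P.submodule ≤ (P.map f hf).submodule.comap f := by
  induction P with
  | h v hv =>
    rw [Projectivization.map_mk, Projectivization.submodule_mk, Projectivization.submodule_mk,
      Submodule.span_singleton_le_iff_mem, Submodule.mem_comap]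
    exact Submodule.mem_span_singleton_self _

theorem sup_submodule_eq_of_ne {K V : Type*} [Field K] [AddCommGroup V] [Module K V]
    {W : Submodule K V} (hW : Module.finrank K W = 2) {P Q : ℙ K V} (hPQ : P ≠ Q)
    (hP : P.submodule ≤ W) (hQ : Q.submodule ≤ W) : P.submodule ⊔ Q.submodule = W := by
  have : FiniteDimensional K W := .of_finrank_pos (by omega)
  have hrank := finrank_span_eq_card (Projectivization.linearIndependent_pair_iff_ne.2 hPQ)
  rw [Matrix.range_cons_cons_empty, Submodule.span_insert, ← Projectivization.submodule_eq,
    ← Projectivization.submodule_eq, Fintype.card_fin] at hrank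
  exact Submodule.eq_of_le_of_finrank_eq (sup_le hP hQ) (hrank.trans hW.symm)

theorem exists_le_ker_of_finrank_lt {K V : Type*} [Field K] [AddCommGroup V] [Module K V]
    [FiniteDimensional K V] {W : Submodule K V} (hW : Module.finrank K W < Module.finrank K V) :
    ∃ φ : Module.Dual K V, W ≤ LinearMap.ker φ ∧
      Module.finrank K (LinearMap.ker φ) + 1 = Module.finrank K V := by
  have hlt : W < ⊤ := by
    refine lt_top_iff_ne_top.2 fun htop => hW.ne ?_
    rw [htop, finrank_top]
  obtain ⟨φ, hφ, hle⟩ := Submodule.exists_le_ker_of_lt_top W hlt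
  exact ⟨φ, hle, Module.Dual.finrank_ker_add_one_of_ne_zero hφ⟩

end LinearAlgebra

theorem CoversWith.eq_univ {F V : Type*} [Field F] [AddCommGroup V] [Module F V]
    {S : Set (ℙ F V)} (h : CoversWith 0 S) : S = Set.univ := by
  refine Set.eq_univ_of_forall fun A => ?_
  obtain ⟨T, hTS, hT, hA⟩ := h A
  rw [zero_add, Nat.cast_one, Set.encard_le_one_iff_eq] at hT
  obtain rfl | ⟨P, rfl⟩ := hT
  · have hrank := A.finrank_submodule
    rw [iSup_emptyset, le_bot_iff] at hA
    rw [hA, finrank_bot] at hrank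
    exact absurd hrank zero_ne_one
  · rw [iSup_singleton] at hA
    have : FiniteDimensional F P.submodule :=
      .of_finrank_pos (P.finrank_submodule.symm ▸ zero_lt_one)
    have hAP : A = P := Projectivization.submodule_injective
      (Submodule.eq_of_le_of_finrank_eq hA (by rw [A.finrank_submodule, P.finrank_submodule]))
    exact hAP ▸ hTS rfl

section Subplane

variable {F : Type*} [Field F] {K : Subfield F}

theorem subplaneIncl_injective (K : Subfield F) : Function.Injective (subplaneIncl K) := by
  intro P Q h
  induction P with
  | h u hu =>
  induction Q with
  | h v hv =>
    obtain ⟨a, ha⟩ := (Projectivization.mk_eq_mk_iff' F _ _ _ _).1 h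
    have ha' : ∀ i, a * (v i : F) = u i := fun i => congrFun ha i
    obtain ⟨i, hi⟩ := Function.ne_iff.1 hv
    have hi' : (v i : F) ≠ 0 := fun h => hi (Subtype.ext h)
    refine (Projectivization.mk_eq_mk_iff' K _ _ _ _).2 ⟨u i / v i, ?_⟩
    ext j
    simp only [Pi.smul_apply, smul_eq_mul, Subfield.coe_mul, Subfield.coe_div]
    rw [← ha' i, mul_div_cancel_right₀ _ hi', ha' j]

theorem range_subplaneIncl_ne_univ (hK : K ≠ ⊤) : Set.range (subplaneIncl K) ≠ Set.univ := by
  obtain ⟨ω, -, hω⟩ := SetLike.exists_of_lt hK.lt_top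
  have hv : (![1, ω, 0] : Fin 3 → F) ≠ 0 := fun h => one_ne_zero (congrFun h 0)
  refine fun h => hω ?_
  obtain ⟨P, hP⟩ := h.symm ▸ Set.mem_univ (Projectivization.mk F _ hv)
  induction P with
  | h u hu =>
    obtain ⟨c, hc⟩ := (Projectivization.mk_eq_mk_iff' F _ _ _ _).1 hP
    have hu0 : c = u 0 := (mul_one c).symm.trans (congrFun hc 0)
    have hu1 : c * ω = u 1 := congrFun hc 1
    have hc0 : c ≠ 0 := by
      rintro rfl
      exact hu (coordIncl_injective K (by simpa using hc.symm))
    rw [eq_div_of_mul_eq hc0 ((mul_comm _ _).trans hu1), hu0]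
    exact div_mem (u 1).2 (u 0).2

theorem exists_finrank_eq_two_mem_span_coordIncl (h : Module.finrank K F = 2) (v : Fin 3 → F) :
    ∃ W : Submodule K (Fin 3 → K), Module.finrank K W = 2 ∧
      v ∈ Submodule.span F (coordIncl K '' W) := by
  have : FiniteDimensional K F := .of_finrank_pos (by omega)
  let b := Module.finBasisOfFinrankEq K F h
  let a : Fin 2 → Fin 3 → K := fun j i => b.repr (v i) j
  have hv : v = ∑ j, b j • coordIncl K (a j) := by
    ext i
    rw [Finset.sum_apply]
    exact (b.sum_repr (v i)).symm.trans (Finset.sum_congr rfl fun j _ => mul_comm _ _)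
  have hrank : Module.finrank K (Submodule.span K (Set.range a)) ≤ 2 :=
    (finrank_range_le_card a).trans_eq (Fintype.card_fin 2)
  obtain ⟨φ, hle, hφ⟩ := exists_le_ker_of_finrank_lt (W := Submodule.span K (Set.range a))
    (by rw [Module.finrank_fin_fun]; omega)
  rw [Module.finrank_fin_fun] at hφ
  refine ⟨LinearMap.ker φ, by omega, ?_⟩
  rw [hv]
  exact Submodule.sum_mem _ fun j _ => Submodule.smul_mem _ _
    (Submodule.subset_span ⟨a j, hle (Submodule.subset_span ⟨j, rfl⟩), rfl⟩)

theorem IsDoubleBlocking.coversWith_image (h : Module.finrank K F = 2)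
    {B : Set (ℙ K (Fin 3 → K))} (hB : IsDoubleBlocking B) :
    CoversWith 1 (subplaneIncl K '' B) := by
  intro A
  obtain ⟨W, hW, hA⟩ := exists_finrank_eq_two_mem_span_coordIncl h A.rep
  obtain ⟨P, Q, ⟨hPB, hPW⟩, ⟨hQB, hQW⟩, hPQ⟩ :=
    Set.one_lt_encard_iff.1 (lt_of_lt_of_le Nat.one_lt_ofNat (hB W hW))
  refine ⟨{subplaneIncl K P, subplaneIncl K Q},
    Set.pair_subset ⟨P, hPB, rfl⟩ ⟨Q, hQB, rfl⟩,
    (Set.encard_pair fun h => hPQ (subplaneIncl_injective K h)).le, ?_⟩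
  have hWle : W ≤ ((subplaneIncl K P).submodule ⊔ (subplaneIncl K Q).submodule).comap
      (coordIncl K) := by
    rw [← sup_submodule_eq_of_ne hW hPQ hPW hQW]
    exact sup_le
      ((submodule_le_comap_submodule_map _ _ P).trans (Submodule.comap_mono le_sup_left))
      ((submodule_le_comap_submodule_map _ _ Q).trans (Submodule.comap_mono le_sup_right))
  rw [iSup_pair, A.submodule_eq, Submodule.span_singleton_le_iff_mem]
  exact Submodule.span_le (R := F).2 (Set.image_subset_iff.2 hWle) hA

theorem IsDoubleBlocking.isSaturating_image (h : Module.finrank K F = 2)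
    {B : Set (ℙ K (Fin 3 → K))} (hB : IsDoubleBlocking B) :
    IsSaturating 1 (subplaneIncl K '' B) := by
  refine ⟨hB.coversWith_image h, fun k hk => Nat.one_le_iff_ne_zero.2 ?_⟩
  rintro rfl
  have hK : K ≠ ⊤ := by
    rintro rfl
    have := finrank_eq_one (R := (⊤ : Subfield F)) (1 : F) one_ne_zero fun x =>
      ⟨⟨x, Subfield.mem_top x⟩, mul_one x⟩
    omega
  exact range_subplaneIncl_ne_univ hK
    (Set.eq_univ_of_univ_subset (hk.eq_univ.symm.subset.trans (Set.image_subset_range _ _)))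

end Subplane

section Blocking

variable {K : Type*} [Field K] {A B : Set (ℙ K (Fin 3 → K))}

open scoped Pointwise

/-- A blocking set of `PG(2, K)`: every line, given as a two-dimensional subspace of `K³`,
contains at least one point of `B`. -/
def IsBlocking (B : Set (ℙ K (Fin 3 → K))) : Prop :=
  ∀ W : Submodule K (Fin 3 → K), Module.finrank K W = 2 → ∃ P ∈ B, P.submodule ≤ W

theorem IsBlocking.smul (hB : IsBlocking B) (g : (Fin 3 → K) ≃ₗ[K] (Fin 3 → K)) :
    IsBlocking (g • B) := by
  intro W hW
  have hrank : Module.finrank K (W.comap (g : (Fin 3 → K) →ₗ[K] (Fin 3 → K))) = 2 := by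
    rw [Submodule.comap_equiv_eq_map_symm, LinearEquiv.finrank_map_eq, hW]
  obtain ⟨P, hP, hPW⟩ := hB _ hrank
  refine ⟨g • P, Set.smul_mem_smul_set hP, ?_⟩
  induction P with
  | h v hv =>
    rw [Projectivization.smul_mk, Projectivization.submodule_mk,
      Submodule.span_singleton_le_iff_mem]
    exact hPW (Submodule.mem_span_singleton_self v)

theorem IsBlocking.isDoubleBlocking_union (hA : IsBlocking A) (hB : IsBlocking B)
    (hAB : Disjoint A B) : IsDoubleBlocking (A ∪ B) := by
  intro W hW
  obtain ⟨P, hPA, hPW⟩ := hA W hW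
  obtain ⟨Q, hQB, hQW⟩ := hB W hW
  rw [← Set.encard_pair (hAB.ne_of_mem hPA hQB)]
  exact Set.encard_le_encard (Set.pair_subset ⟨.inl hPA, hPW⟩ ⟨.inr hQB, hQW⟩)

end Blocking

section Redei

variable {K : Type*} [Field K]

open scoped Pointwise

/-- The point `(x, y)` of the affine part `Z = 1` of `PG(2, K)`. -/
def affinePoint (x y : K) : ℙ K (Fin 3 → K) :=
  .mk K ![x, y, 1] fun h => one_ne_zero (congrFun h 2)

/-- The common point at infinity of the affine lines of slope `m`. -/
def pointAtInfinity (m : K) : ℙ K (Fin 3 → K) :=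
  .mk K ![1, m, 0] fun h => one_ne_zero (congrFun h 0)

/-- The set of directions determined by the graph of an additive function `f`, that is, of the
slopes of its chords; by additivity the chords through the origin suffice. -/
def directions (f : K →+ K) : Set K :=
  Set.range fun x : Kˣ => f x / x

/-- The set of Rédei type attached to an additive function `f`: the graph of `f` together with
the points at infinity in the directions determined by it. -/
def redeiSet (f : K →+ K) : Set (ℙ K (Fin 3 → K)) :=
  (Set.range fun x => affinePoint x (f x)) ∪ pointAtInfinity '' directions f

variable (f : K →+ K)

theorem affinePoint_injective : Function.Injective2 (affinePoint (K := K)) := by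
  intro x x' y y' h
  obtain ⟨a, ha⟩ := (Projectivization.mk_eq_mk_iff' K _ _ _ _).1 h
  obtain rfl : a = 1 := by simpa using congrFun ha 2
  rw [one_smul] at ha
  exact ⟨(congrFun ha 0).symm, (congrFun ha 1).symm⟩

theorem pointAtInfinity_injective : Function.Injective (pointAtInfinity (K := K)) := by
  intro m m' h
  obtain ⟨a, ha⟩ := (Projectivization.mk_eq_mk_iff' K _ _ _ _).1 h
  obtain rfl : a = 1 := by simpa using congrFun ha 0
  rw [one_smul] at ha
  exact (congrFun ha 1).symm

theorem affinePoint_ne_pointAtInfinity (x y m : K) : affinePoint x y ≠ pointAtInfinity m := by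
  intro h
  obtain ⟨a, ha⟩ := (Projectivization.mk_eq_mk_iff' K _ _ _ _).1 h
  simpa using congrFun ha 2

theorem mk_mem_redeiSet {x : K} (hx : x ≠ 0) (h : ![x, f x, 0] ≠ 0) :
    Projectivization.mk K ![x, f x, 0] h ∈ redeiSet f := by
  refine .inr ⟨f x / x, ⟨Units.mk0 x hx, rfl⟩, ?_⟩
  refine (Projectivization.mk_eq_mk_iff' K _ _ _ _).2 ⟨x⁻¹, ?_⟩
  ext i
  fin_cases i <;> simp [hx, div_eq_inv_mul]

theorem exists_eq_mk_of_mem_redeiSet {P : ℙ K (Fin 3 → K)} (hP : P ∈ redeiSet f) :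
    ∃ (x z : K) (h : ![x, f x, z] ≠ 0), (z = 0 ∨ z = 1) ∧
      P = Projectivization.mk K ![x, f x, z] h := by
  obtain ⟨x, rfl⟩ | ⟨_, ⟨x, rfl⟩, rfl⟩ := hP
  · exact ⟨x, 1, _, .inr rfl, rfl⟩
  · refine ⟨x, 0, fun h => x.ne_zero (congrFun h 0), .inl rfl, ?_⟩
    refine (Projectivization.mk_eq_mk_iff' K _ _ _ _).2 ⟨(x : K)⁻¹, ?_⟩
    ext i
    fin_cases i <;> simp [div_eq_inv_mul]

theorem isBlocking_redeiSet [Finite K] : IsBlocking (redeiSet f) := by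
  intro W hW
  obtain ⟨φ, hle, hφ⟩ := exists_le_ker_of_finrank_lt (W := W)
    (by rw [Module.finrank_fin_fun]; omega)
  rw [Module.finrank_fin_fun] at hφ
  obtain rfl : W = LinearMap.ker φ := Submodule.eq_of_le_of_finrank_eq hle (by omega)
  let g : K →+ K :=
    { toFun x := φ ![x, f x, 0]
      map_zero' := by rw [map_zero]; exact (congrArg φ (by simp)).trans (map_zero φ)
      map_add' x y := by rw [map_add, ← map_add φ]; exact congrArg φ (by simp) }
  by_cases hg : Function.Injective g
  · obtain ⟨x, hx⟩ := Finite.surjective_of_injective hg (-φ ![0, 0, 1])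
    refine ⟨affinePoint x (f x), .inl ⟨x, rfl⟩, ?_⟩
    rw [affinePoint, Projectivization.submodule_mk, Submodule.span_singleton_le_iff_mem,
      LinearMap.mem_ker]
    calc φ ![x, f x, 1] = φ (![x, f x, 0] + ![0, 0, 1]) := congrArg φ (by simp)
      _ = g x + φ ![0, 0, 1] := map_add φ _ _
      _ = 0 := by rw [hx, neg_add_cancel]
  · obtain ⟨x, hgx, hx⟩ : ∃ x, g x = 0 ∧ x ≠ 0 := by
      simpa [injective_iff_map_eq_zero] using hg
    refine ⟨_, mk_mem_redeiSet f hx fun h => hx (congrFun h 0), ?_⟩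
    rwa [Projectivization.submodule_mk, Submodule.span_singleton_le_iff_mem, LinearMap.mem_ker]

theorem ncard_redeiSet [Finite K] :
    (redeiSet f).ncard = Nat.card K + (directions f).ncard := by
  have hdisj : Disjoint (Set.range fun x => affinePoint x (f x))
      (pointAtInfinity '' directions f) := by
    rw [Set.disjoint_left]
    rintro _ ⟨x, rfl⟩ ⟨m, -, h⟩
    exact affinePoint_ne_pointAtInfinity _ _ _ h.symm
  rw [redeiSet, Set.ncard_union_eq hdisj (Set.toFinite _) (Set.toFinite _),
    Set.ncard_image_of_injective _ pointAtInfinity_injective,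
    Set.ncard_range_of_injective fun x y h => (affinePoint_injective h).1]

theorem disjoint_redeiSet_smul (g : (Fin 3 → K) ≃ₗ[K] (Fin 3 → K))
    (h : ∀ x y z w t : K, (z = 0 ∨ z = 1) → (w = 0 ∨ w = 1) →
      g ![y, f y, w] = t • ![x, f x, z] → ![y, f y, w] = 0) :
    Disjoint (redeiSet f) (g • redeiSet f) := by
  rw [Set.disjoint_left]
  rintro P hP ⟨Q, hQ, hgQ⟩
  obtain ⟨x, z, hv, hz, rfl⟩ := exists_eq_mk_of_mem_redeiSet f hP
  obtain ⟨y, w, hu, hw, rfl⟩ := exists_eq_mk_of_mem_redeiSet f hQ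
  obtain ⟨t, ht⟩ := (Projectivization.mk_eq_mk_iff' K _ _ _ _).1 hgQ
  exact hu (h x y z w t hz hw ht.symm)

theorem exists_isDoubleBlocking_of_disjoint [Finite K] {g : (Fin 3 → K) ≃ₗ[K] (Fin 3 → K)}
    (h : Disjoint (redeiSet f) (g • redeiSet f)) :
    ∃ B : Set (ℙ K (Fin 3 → K)), IsDoubleBlocking B ∧
      B.ncard = 2 * (Nat.card K + (directions f).ncard) := by
  have hf := isBlocking_redeiSet f
  refine ⟨_, hf.isDoubleBlocking_union (hf.smul g) h, ?_⟩
  rw [Set.ncard_union_eq h (Set.toFinite _) (Set.toFinite _), Set.ncard_smul_set,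
    ncard_redeiSet, two_mul]

end Redei

section PowerMaps

variable {K : Type*} [Field K]

theorem ncard_range_units_pow_mul [Finite K] {m : ℕ} (hm : m ∣ Nat.card K - 1) :
    (Set.range fun x : Kˣ => x ^ m).ncard * m = Nat.card K - 1 := by
  have h := IsCyclic.card_powMonoidHom_range (G := Kˣ) m
  rw [Nat.card_units, Nat.gcd_eq_right hm] at h
  rw [← Nat.div_mul_cancel hm, ← h]
  rfl

theorem exists_units_forall_pow_ne [Finite K] {m : ℕ} (hm : m ∣ Nat.card K - 1) (hm1 : m ≠ 1) :
    ∃ v : Kˣ, ∀ x : Kˣ, x ^ m ≠ v := by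
  by_contra! h
  have hcard := ncard_range_units_pow_mul hm
  rw [Set.range_eq_univ.2 h, Set.ncard_univ, Nat.card_units] at hcard
  have := Finite.one_lt_card (α := K)
  exact hm1 (Nat.eq_of_mul_eq_mul_left (by omega) (hcard.trans (mul_one _).symm))

theorem sum_units_inv_mul_one_add_mul_pow_pow [Fintype K] [DecidableEq K] {m : ℕ} (hm : m ≠ 0)
    (hcard : m * m < Fintype.card K - 1) (w : K) :
    ∑ x : Kˣ, ((x : K)⁻¹ * (1 + w * (x : K) ^ m)) ^ m = -(m * w) := by
  have hexpand (x : Kˣ) : ((x : K)⁻¹ * (1 + w * (x : K) ^ m)) ^ m =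
      ∑ i ∈ Finset.range m, w ^ (i + 1) * (m.choose (i + 1)) * (x : K) ^ (m * i) +
        ((x⁻¹ : Kˣ) : K) ^ m := by
    rw [mul_pow, add_comm, add_pow, Finset.mul_sum, Finset.sum_range_succ']
    congr 1
    · refine Finset.sum_congr rfl fun i _ => ?_
      have hx : (x : K)⁻¹ ^ m * ((x : K) ^ m) ^ (i + 1) = (x : K) ^ (m * i) := by
        rw [pow_succ', ← mul_assoc, ← mul_pow, inv_mul_cancel₀ x.ne_zero, one_pow, one_mul, pow_mul]
      rw [mul_pow, one_pow, ← hx]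
      ring
    · simp
  have hinv : ∑ x : Kˣ, ((x⁻¹ : Kˣ) : K) ^ m = 0 := by
    rw [(inv_involutive (G := Kˣ)).bijective.sum_comp fun x : Kˣ => (x : K) ^ m,
      FiniteField.sum_pow_units, if_neg]
    exact Nat.not_dvd_of_pos_of_lt hm.bot_lt ((Nat.le_mul_self m).trans_lt hcard)
  simp_rw [hexpand, Finset.sum_add_distrib, hinv, add_zero]
  rw [Finset.sum_comm]
  simp_rw [← Finset.mul_sum, FiniteField.sum_pow_units]
  rw [Finset.sum_eq_single_of_mem 0 (Finset.mem_range.2 hm.bot_lt)]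
  · simp [mul_comm]
  · intro i hi hi0
    rw [if_neg, mul_zero]
    refine Nat.not_dvd_of_pos_of_lt (Nat.mul_pos hm.bot_lt hi0.bot_lt) (lt_of_le_of_lt ?_ hcard)
    exact Nat.mul_le_mul_left m (Finset.mem_range.1 hi).le

theorem exists_units_forall_one_add_mul_pow_ne_mul [Finite K] {m : ℕ} (hm : (m : K) ≠ 0)
    (hcard : m * m < Nat.card K - 1) {w : K} (hw : w ≠ 0)
    (h : ∀ x : Kˣ, 1 + w * (x : K) ^ m ≠ 0) :
    ∃ z : Kˣ, ∀ x : Kˣ, 1 + w * (x : K) ^ m ≠ z * x := by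
  classical
  have := Fintype.ofFinite K
  rw [Nat.card_eq_fintype_card] at hcard
  have hm0 : m ≠ 0 := by
    rintro rfl
    exact hm Nat.cast_zero
  by_contra! hsurj
  let H : Kˣ → Kˣ := fun x => x⁻¹ * Units.mk0 _ (h x)
  have hH : Function.Bijective H := by
    refine Function.Surjective.bijective_of_finite fun z => ?_
    obtain ⟨x, hx⟩ := hsurj z
    exact ⟨x, inv_mul_eq_of_eq_mul (Units.ext (hx.trans (mul_comm _ _)))⟩
  -- Hermite's criterion: the `m`-th powers of the values of a permutation of `Kˣ` sum to zero.
  have hsum : ∑ x : Kˣ, ((H x : Kˣ) : K) ^ m = 0 := by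
    rw [hH.sum_comp fun x : Kˣ => (x : K) ^ m, FiniteField.sum_pow_units, if_neg]
    exact Nat.not_dvd_of_pos_of_lt hm0.bot_lt ((Nat.le_mul_self m).trans_lt hcard)
  have hsum' := sum_units_inv_mul_one_add_mul_pow_pow hm0 hcard w
  simp only [H, Units.val_mul, Units.val_inv_eq_inv_val, Units.val_mk0] at hsum
  exact neg_ne_zero.2 (mul_ne_zero hm hw) (hsum'.symm.trans hsum)

theorem exists_units_forall_mul_pow_add_one_ne [Finite K] {m : ℕ} (hm : m ∣ Nat.card K - 1)
    (hm1 : m ≠ 1) (hmK : (m : K) ≠ 0) (hcard : m * m < Nat.card K - 1) :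
    ∃ b : Kˣ, ∀ u : Kˣ, (b : K) * (u : K) ^ m + 1 ≠ 0 ∧ (b : K) * (u : K) ^ m + 1 ≠ u := by
  obtain ⟨v, hv⟩ := exists_units_forall_pow_ne hm hm1
  have hv' (x : Kˣ) : 1 + -(v : K) * (x : K) ^ m ≠ 0 := by
    intro h
    refine hv x⁻¹ ?_
    rw [inv_pow, inv_eq_iff_mul_eq_one, mul_comm]
    ext
    push_cast
    linear_combination -h
  obtain ⟨z, hz⟩ := exists_units_forall_one_add_mul_pow_ne_mul hmK hcard
    (neg_ne_zero.2 v.ne_zero) hv'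
  refine ⟨-v * z⁻¹ ^ m, fun u => ?_⟩
  have hb : ((-v * z⁻¹ ^ m : Kˣ) : K) * (u : K) ^ m + 1 =
      1 + -(v : K) * ((z⁻¹ * u : Kˣ) : K) ^ m := by
    push_cast
    ring
  rw [hb]
  refine ⟨hv' _, (hz _).trans_eq ?_⟩
  rw [Units.val_mul, Units.mul_inv_cancel_left]

end PowerMaps

section Frobenius

variable (k K : Type*) [Field k] [Field K] [Algebra k K]

open scoped Pointwise

/-- The additive function `x ↦ x ^ |k|` on an extension `K` of a finite field `k`. -/
noncomputable def frobeniusAddHom [Finite k] : K →+ K :=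
  letI := Fintype.ofFinite k
  (FiniteField.frobeniusAlgHom k K : K →+ K)

variable {k K}

theorem frobeniusAddHom_apply [Finite k] (x : K) : frobeniusAddHom k K x = x ^ Nat.card k := by
  let := Fintype.ofFinite k
  rw [Nat.card_eq_fintype_card]
  rfl

theorem frobeniusAddHom_injective [Finite k] : Function.Injective (frobeniusAddHom k K) :=
  let := Fintype.ofFinite k
  (FiniteField.frobeniusAlgHom k K).injective

theorem cast_natCard_eq_zero [Finite k] : (Nat.card k : K) = 0 := by
  have := Fintype.ofFinite k
  rw [← map_natCast (algebraMap k K), Nat.card_eq_fintype_card, FiniteField.cast_card_eq_zero,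
    map_zero]

theorem natCard_sub_one_dvd [Finite K] : Nat.card k - 1 ∣ Nat.card K - 1 := by
  rw [Module.natCard_eq_pow_finrank (K := k) (V := K)]
  simpa using Nat.sub_dvd_pow_sub_pow (Nat.card k) 1 (Module.finrank k K)

theorem natCard_sq_le_of_lt [Finite K] (h : Nat.card k < Nat.card K) :
    Nat.card k ^ 2 ≤ Nat.card K := by
  have : Finite k := .of_injective _ (algebraMap k K).injective
  rw [Module.natCard_eq_pow_finrank (K := k) (V := K)] at h ⊢
  refine Nat.pow_le_pow_right Nat.card_pos ?_
  by_contra! hlt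
  exact h.not_ge ((Nat.pow_le_pow_right Nat.card_pos (Nat.lt_succ_iff.1 hlt)).trans (pow_one _).le)

theorem ncard_directions_frobeniusAddHom_mul [Finite k] [Finite K] :
    (directions (frobeniusAddHom k K)).ncard * (Nat.card k - 1) = Nat.card K - 1 := by
  have hdir : directions (frobeniusAddHom k K) =
      Units.val '' Set.range fun x : Kˣ => x ^ (Nat.card k - 1) := by
    rw [← Set.range_comp]
    refine congrArg Set.range (funext fun x => ?_)
    rw [frobeniusAddHom_apply, Function.comp_apply, Units.val_pow_eq_pow_val,
      div_eq_iff x.ne_zero, ← pow_succ, Nat.sub_add_cancel Nat.card_pos]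
  rw [hdir, Set.ncard_image_of_injective _ Units.val_injective,
    ncard_range_units_pow_mul natCard_sub_one_dvd]

theorem exists_forall_mul_pow_add_ne [Finite K] (h : Nat.card k < Nat.card K) :
    ∃ β c : K, β ≠ 0 ∧ ∀ u : K, u ≠ 0 →
      β * (u ^ (Nat.card k - 1)) ^ Nat.card k + c ≠ 0 ∧
      β * (u ^ (Nat.card k - 1)) ^ Nat.card k + c ≠ u ^ Nat.card k := by
  have : Finite k := .of_injective _ (algebraMap k K).injective
  have hk : 2 ≤ Nat.card k := Finite.one_lt_card
  have hsq := natCard_sq_le_of_lt h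
  -- Hermite's criterion needs an element that is not a `(|k| - 1)`-th power: none if `|k| = 2`.
  obtain hk2 | hk3 := hk.eq_or_lt
  · obtain ⟨β, -, hβ⟩ := Set.exists_mem_notMem_of_ncard_lt_ncard (s := {(0 : K), 1})
      (t := Set.univ) (by rw [Set.ncard_pair zero_ne_one, Set.ncard_univ]; omega)
    obtain ⟨hβ0, hβ1⟩ := not_or.1 hβ
    refine ⟨β, 0, hβ0, fun u hu => ?_⟩
    rw [← hk2, pow_one, add_zero]
    exact ⟨mul_ne_zero hβ0 (pow_ne_zero 2 hu), fun h => hβ1 (mul_right_cancel₀ (pow_ne_zero 2 hu)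
      (h.trans (one_mul _).symm))⟩
  · have hkK : ((Nat.card k - 1 : ℕ) : K) ≠ 0 := by
      rw [Nat.cast_sub Nat.card_pos, cast_natCard_eq_zero]
      simp
    obtain ⟨b, hb⟩ := exists_units_forall_mul_pow_add_one_ne (K := K) natCard_sub_one_dvd
      (by omega) hkK (by
        obtain ⟨m, hm⟩ : ∃ m, Nat.card k = m + 1 := ⟨_, (Nat.sub_add_cancel Nat.card_pos).symm⟩
        rw [hm] at hsq hk ⊢
        rw [Nat.add_sub_cancel, Nat.lt_sub_iff_add_lt]
        nlinarith)
    have hfrob (u : K) : (b : K) ^ Nat.card k * (u ^ (Nat.card k - 1)) ^ Nat.card k + 1 =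
        frobeniusAddHom k K (b * u ^ (Nat.card k - 1) + 1) := by
      rw [map_add]
      simp only [frobeniusAddHom_apply, mul_pow, one_pow]
    refine ⟨(b : K) ^ Nat.card k, 1, pow_ne_zero _ b.ne_zero, fun u hu => ?_⟩
    rw [hfrob, ← frobeniusAddHom_apply]
    have := hb (Units.mk0 u hu)
    exact ⟨(map_ne_zero_iff _ frobeniusAddHom_injective).2 this.1,
      frobeniusAddHom_injective.ne this.2⟩

/-- The collineation `(X : Y : Z) ↦ (X : Z : βY + cZ)`; for suitable `β` and `c` it moves the Rédei
set of a Frobenius map off itself. -/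
def swapShear {β : K} (hβ : β ≠ 0) (c : K) : (Fin 3 → K) ≃ₗ[K] (Fin 3 → K) where
  toFun v := ![v 0, v 2, β * v 1 + c * v 2]
  map_add' v w := by ext i; fin_cases i <;> simp; ring
  map_smul' t v := by ext i; fin_cases i <;> simp; ring
  invFun v := ![v 0, β⁻¹ * (v 2 - c * v 1), v 1]
  left_inv v := by ext i; fin_cases i <;> simp [hβ]
  right_inv v := by ext i; fin_cases i <;> simp [hβ]

theorem disjoint_redeiSet_frobeniusAddHom_smul_swapShear [Finite k] {β : K} (hβ : β ≠ 0) {c : K}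
    (h : ∀ u : K, u ≠ 0 →
      β * (u ^ (Nat.card k - 1)) ^ Nat.card k + c ≠ 0 ∧
      β * (u ^ (Nat.card k - 1)) ^ Nat.card k + c ≠ u ^ Nat.card k) :
    Disjoint (redeiSet (frobeniusAddHom k K))
      (swapShear hβ c • redeiSet (frobeniusAddHom k K)) := by
  have hk : Nat.card k ≠ 0 := Nat.card_pos.ne'
  refine disjoint_redeiSet_smul _ _ fun x y z w t hz hw he => ?_
  rw [frobeniusAddHom_apply, frobeniusAddHom_apply] at he
  have hX : y = t * x := congrFun he 0
  have hY : w = t * x ^ Nat.card k := congrFun he 1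
  have hZ : β * y ^ Nat.card k + c * w = t * z := congrFun he 2
  obtain rfl | rfl := hw
  · have hy : y = 0 := by
      obtain ht | hx := mul_eq_zero.1 hY.symm
      · rw [hX, ht, zero_mul]
      · rw [hX, eq_zero_of_pow_eq_zero hx, mul_zero]
    rw [hy, map_zero]
    simp
  · have hx : x ≠ 0 := by
      rintro rfl
      rw [zero_pow hk, mul_zero] at hY
      exact one_ne_zero hY
    have ht : t = x⁻¹ ^ Nat.card k := by
      rw [inv_pow]
      exact eq_inv_of_mul_eq_one_left hY.symm
    have hy : y = x⁻¹ ^ (Nat.card k - 1) := by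
      rw [hX, ht, ← pow_sub_one_mul hk, mul_assoc, inv_mul_cancel₀ hx, mul_one]
    rw [ht, hy, mul_one] at hZ
    obtain ⟨h0, h1⟩ := h x⁻¹ (inv_ne_zero hx)
    obtain rfl | rfl := hz
    · exact absurd (hZ.trans (mul_zero _)) h0
    · exact absurd (hZ.trans (mul_one _)) h1

theorem exists_isDoubleBlocking_ncard_eq_frobenius [Finite K] (h : Nat.card k < Nat.card K) :
    ∃ B : Set (ℙ K (Fin 3 → K)), IsDoubleBlocking B ∧
      (B.ncard : ℝ) = 2 * (Nat.card K : ℝ) +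
        2 * (((Nat.card K : ℝ) - 1) / ((Nat.card k : ℝ) - 1)) := by
  have : Finite k := .of_injective _ (algebraMap k K).injective
  obtain ⟨β, c, hβ, hβc⟩ := exists_forall_mul_pow_add_ne h
  obtain ⟨B, hB, hcard⟩ := exists_isDoubleBlocking_of_disjoint _
    (disjoint_redeiSet_frobeniusAddHom_smul_swapShear hβ hβc)
  refine ⟨B, hB, ?_⟩
  have hk : (1 : ℝ) < Nat.card k := mod_cast Finite.one_lt_card (α := k)
  have hdir := congrArg (Nat.cast (R := ℝ)) (ncard_directions_frobeniusAddHom_mul (k := k) (K := K))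
  rw [Nat.cast_mul, Nat.cast_sub Nat.card_pos, Nat.cast_sub Nat.card_pos, Nat.cast_one] at hdir
  rw [hcard, ← hdir, mul_div_cancel_right₀ _ (sub_ne_zero.2 hk.ne')]
  push_cast
  ring

end Frobenius

theorem ncard_setOf_eq_mul_natCard {G H : Type*} [AddGroup G] [AddGroup H] {f : G →+ H}
    (hf : Function.Surjective f) (a : H) : {x | f x = a}.ncard * Nat.card H = Nat.card G := by
  obtain ⟨t, rfl⟩ := hf a
  have hfiber : {x | f x = f t} = (· + t) '' (f.ker : Set G) := by
    ext x
    rw [Set.image_add_right, Set.mem_preimage, SetLike.mem_coe, AddMonoidHom.mem_ker, map_add,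
      map_neg, add_neg_eq_zero]
    rfl
  rw [hfiber, Set.ncard_image_of_injective _ (add_left_injective t), ← f.ker.card_mul_index,
    AddSubgroup.index_ker, AddMonoidHom.range_eq_top.2 hf, AddSubgroup.card_top]
  rfl

section Trace

variable (k K : Type*) [Field k] [Field K] [Algebra k K]

open scoped Pointwise

/-- The trace from `K` to a subfield `k`, as an additive function from `K` to itself. -/
noncomputable def traceAddHom : K →+ K :=
  (algebraMap k K : k →+ K).comp (Algebra.trace k K).toAddMonoidHom

variable {k K}

theorem traceAddHom_apply (x : K) :
    traceAddHom k K x = algebraMap k K (Algebra.trace k K x) :=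
  rfl

theorem directions_traceAddHom (h : ¬ Function.Injective (Algebra.trace k K)) :
    directions (traceAddHom k K) = insert 0 {x : K | Algebra.trace k K x = 1}⁻¹ := by
  ext m
  constructor
  · rintro ⟨x, rfl⟩
    by_cases hx : Algebra.trace k K x = 0
    · exact .inl (by simp only [traceAddHom_apply, hx, map_zero, zero_div])
    · refine .inr ?_
      simp only [traceAddHom_apply, Set.mem_inv, Set.mem_ofPred_eq, inv_div]
      rw [div_eq_inv_mul, ← map_inv₀, ← Algebra.smul_def, map_smul, smul_eq_mul,
        inv_mul_cancel₀ hx]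
  · rintro (rfl | hm)
    · obtain ⟨x, hx, hx0⟩ : ∃ x, Algebra.trace k K x = 0 ∧ x ≠ 0 := by
        simpa [injective_iff_map_eq_zero] using h
      exact ⟨Units.mk0 x hx0, by simp [traceAddHom_apply, hx]⟩
    · rw [Set.mem_inv, Set.mem_ofPred_eq] at hm
      have hm0 : m⁻¹ ≠ 0 := by
        intro h0
        rw [h0, map_zero] at hm
        exact zero_ne_one hm
      exact ⟨Units.mk0 m⁻¹ hm0, by simp [traceAddHom_apply, hm]⟩

section Separable

variable [FiniteDimensional k K] [Algebra.IsSeparable k K]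

theorem exists_trace_mul_eq {a : K} (ha : a ≠ 0) (c : k) : ∃ b, Algebra.trace k K (a * b) = c := by
  obtain ⟨t, rfl⟩ := Algebra.trace_surjective k K c
  exact ⟨a⁻¹ * t, by rw [mul_inv_cancel_left₀ ha]⟩

theorem exists_trace_eq_zero_and_trace_mul_eq {θ : K} (hθ : θ ∉ Set.range (algebraMap k K))
    (d : k) : ∃ η, Algebra.trace k K η = 0 ∧ Algebra.trace k K (θ * η) = d := by
  obtain ⟨t, ht⟩ := Algebra.trace_surjective k K 1
  set c := Algebra.trace k K (θ * t)
  obtain ⟨b, hb⟩ := exists_trace_mul_eq (k := k)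
    (sub_ne_zero.2 fun h : θ = algebraMap k K c => hθ ⟨c, h.symm⟩) d
  refine ⟨b - Algebra.trace k K b • t, ?_, ?_⟩
  · rw [map_sub, map_smul, ht, smul_eq_mul, mul_one, sub_self]
  · rw [← hb, mul_sub, mul_smul_comm, sub_mul, ← Algebra.smul_def, map_sub, map_sub, map_smul,
      map_smul, smul_eq_mul, smul_eq_mul, mul_comm c]

theorem exists_forall_trace_div_sub_ne [Finite k] (θ : K) :
    ∃ δ : K, δ ≠ 0 ∧ ∃ ρ : k, ∀ a : k, Algebra.trace k K (δ / (algebraMap k K a - θ)) - a ≠ ρ := by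
  have hinv : (algebraMap k K 1 - θ)⁻¹ - (algebraMap k K 0 - θ)⁻¹ ≠ 0 := by
    rw [sub_ne_zero, Ne, inv_inj]
    simp
  obtain ⟨δ, hδ⟩ := exists_trace_mul_eq hinv (1 : k)
  have hδ0 : δ ≠ 0 := by
    rintro rfl
    rw [mul_zero, map_zero] at hδ
    exact zero_ne_one hδ
  -- This choice of `δ` makes the map below non-injective, hence not surjective.
  let g : k → k := fun a => Algebra.trace k K (δ / (algebraMap k K a - θ)) - a
  have hg : g 0 = g 1 := by
    rw [sub_mul, inv_mul_eq_div, inv_mul_eq_div, map_sub] at hδ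
    linear_combination -hδ
  have hnsurj : ¬ Function.Surjective g := fun hs =>
    zero_ne_one (Finite.injective_iff_surjective.2 hs hg)
  exact ⟨δ, hδ0, not_forall.1 hnsurj |>.imp fun ρ hρ a ha => hρ ⟨a, ha⟩⟩

end Separable

/-- The collineation `(X : Y : Z) ↦ (δZ : η⁻¹(X + σZ) : Y - θZ)`; for suitable parameters it moves
the Rédei set of a trace map off itself. -/
def cycleShear {δ η : K} (hδ : δ ≠ 0) (hη : η ≠ 0) (σ θ : K) :
    (Fin 3 → K) ≃ₗ[K] (Fin 3 → K) where
  toFun v := ![δ * v 2, η⁻¹ * (v 0 + σ * v 2), v 1 - θ * v 2]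
  map_add' v w := by ext i; fin_cases i <;> simp <;> ring
  map_smul' t v := by ext i; fin_cases i <;> simp <;> ring
  invFun v := ![η * v 1 - σ * (δ⁻¹ * v 0), v 2 + θ * (δ⁻¹ * v 0), δ⁻¹ * v 0]
  left_inv v := by ext i; fin_cases i <;> simp [hδ, hη]
  right_inv v := by ext i; fin_cases i <;> simp [hδ, hη]

theorem disjoint_redeiSet_traceAddHom_smul_cycleShear {δ η σ θ : K} (hδ : δ ≠ 0) (hη : η ≠ 0)
    (hθ : θ ∉ Set.range (algebraMap k K)) (hTη : Algebra.trace k K η = 0)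
    (hTθη : Algebra.trace k K (θ * η) = -1)
    (h : ∀ a : k, Algebra.trace k K (δ / (algebraMap k K a - θ)) - a ≠ Algebra.trace k K σ) :
    Disjoint (redeiSet (traceAddHom k K)) (cycleShear hδ hη σ θ • redeiSet (traceAddHom k K)) := by
  refine disjoint_redeiSet_smul _ _ fun x y z w t hz hw he => ?_
  have hX : δ * w = t * x := congrFun he 0
  have hY : η⁻¹ * (y + σ * w) = t * algebraMap k K (Algebra.trace k K x) := congrFun he 1
  have hZ : algebraMap k K (Algebra.trace k K y) - θ * w = t * z := congrFun he 2
  obtain rfl | rfl := hw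
  · have hy : y = 0 := by
      rw [mul_zero] at hX
      rw [mul_zero, add_zero, inv_mul_eq_iff_eq_mul₀ hη] at hY
      obtain rfl | rfl := mul_eq_zero.1 hX.symm
      · rw [hY, zero_mul, mul_zero]
      · rw [hY, map_zero, map_zero, mul_zero, mul_zero]
    rw [hy, map_zero]
    simp
  · set a := Algebra.trace k K y with ha
    have hne : algebraMap k K a - θ ≠ 0 := fun h => hθ ⟨a, sub_eq_zero.1 h⟩
    rw [mul_one] at hX hY hZ
    obtain rfl | rfl := hz
    · exact absurd (hZ.trans (mul_zero _)) hne
    · rw [mul_one] at hZ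
      subst hZ
      have hx : δ / (algebraMap k K a - θ) = x :=
        (div_eq_iff hne).2 (hX.trans (mul_comm _ _))
      have hy : y + σ = Algebra.trace k K x • (a • η - θ * η) := by
        rw [Algebra.smul_def, Algebra.smul_def, ← sub_mul]
        rw [inv_mul_eq_iff_eq_mul₀ hη] at hY
        linear_combination hY
      have htrace : a + Algebra.trace k K σ = Algebra.trace k K x := by
        rw [ha, ← map_add, hy, map_smul, map_sub, map_smul, hTη, hTθη, smul_zero, zero_sub,
          neg_neg, smul_eq_mul, mul_one]
      exact absurd (by rw [hx, ← htrace, add_sub_cancel_left]) (h a)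

theorem exists_isDoubleBlocking_ncard_eq_trace [Finite K] (h : Nat.card k < Nat.card K) :
    ∃ B : Set (ℙ K (Fin 3 → K)), IsDoubleBlocking B ∧
      (B.ncard : ℝ) = 2 * (Nat.card K : ℝ) + 2 * ((Nat.card K : ℝ) / (Nat.card k : ℝ)) + 2 := by
  have : Finite k := .of_injective _ (algebraMap k K).injective
  obtain ⟨θ, hθ⟩ : ∃ θ : K, θ ∉ Set.range (algebraMap k K) := by
    by_contra! hall
    exact h.not_ge (Nat.card_le_card_of_surjective (algebraMap k K) hall)
  obtain ⟨δ, hδ, ρ, hρ⟩ := exists_forall_trace_div_sub_ne (k := k) θ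
  obtain ⟨σ, rfl⟩ := Algebra.trace_surjective k K ρ
  obtain ⟨η, hTη, hTθη⟩ := exists_trace_eq_zero_and_trace_mul_eq hθ (-1)
  have hη : η ≠ 0 := by
    rintro rfl
    simp at hTθη
  obtain ⟨B, hB, hcard⟩ := exists_isDoubleBlocking_of_disjoint _
    (disjoint_redeiSet_traceAddHom_smul_cycleShear hδ hη hθ hTη hTθη hρ)
  refine ⟨B, hB, ?_⟩
  have hninj : ¬ Function.Injective (Algebra.trace k K) := fun hi =>
    hη (hi (hTη.trans (map_zero _).symm))
  have hfiber : {x : K | Algebra.trace k K x = 1}.ncard * Nat.card k = Nat.card K :=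
    ncard_setOf_eq_mul_natCard (f := (Algebra.trace k K).toAddMonoidHom)
      (Algebra.trace_surjective k K) 1
  have hk : (Nat.card k : ℝ) ≠ 0 := Nat.cast_ne_zero.2 Nat.card_pos.ne'
  rw [hcard, directions_traceAddHom hninj, Set.ncard_insert_of_notMem (by simp), Set.ncard_inv]
  have hdiv : (Nat.card K : ℝ) / Nat.card k = {x : K | Algebra.trace k K x = 1}.ncard := by
    rw [div_eq_iff hk]
    exact_mod_cast hfiber.symm
  rw [hdiv]
  push_cast
  ring

end Trace

section Subfield

theorem exists_subfield_natCard_eq {F : Type*} [Field F] {p n d : ℕ} (hp : p.Prime)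
    (hF : Nat.card F = p ^ n) (hd : d ≠ 0) (hdn : d ∣ n) :
    ∃ K : Subfield F, Nat.card K = p ^ d := by
  have : Fact p.Prime := ⟨hp⟩
  have : Finite F := Nat.finite_of_card_ne_zero (hF ▸ pow_ne_zero n hp.ne_zero)
  have := Fintype.ofFinite F
  have : CharP F p := charP_of_card_eq_prime_pow (Nat.card_eq_fintype_card.symm.trans hF)
  let := ZMod.algebra F p
  have hrank : Module.finrank (ZMod p) F = n :=
    Nat.pow_right_injective hp.two_le ((FiniteField.pow_finrank_eq_natCard p F).trans hF)
  obtain ⟨f⟩ := FiniteField.nonempty_algHom_of_finrank_dvd (F := ZMod p) (K := GaloisField p d)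
    (L := F) (by rwa [GaloisField.finrank p hd, hrank])
  refine ⟨f.toRingHom.fieldRange, ?_⟩
  rw [← GaloisField.card p d hd]
  exact (Nat.card_congr (Equiv.ofInjective f f.injective)).symm

theorem exists_subfield_tower_natCard_eq {F : Type*} [Field F] {p h : ℕ} (hp : p.Prime)
    (hF : Nat.card F = p ^ (6 * h)) (hh : h ≠ 0) :
    ∃ (K : Subfield F) (k : Subfield K), Nat.card K = (p ^ h) ^ 3 ∧ Nat.card k = p ^ h := by
  obtain ⟨K, hK⟩ := exists_subfield_natCard_eq hp hF (d := h * 3) (by omega) ⟨2, by ring⟩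
  obtain ⟨k, hk⟩ := exists_subfield_natCard_eq hp hK hh (dvd_mul_right h 3)
  exact ⟨K, k, hK.trans (pow_mul p h 3), hk⟩

theorem natCard_bot_subfield {F : Type*} [Field F] {p n : ℕ} (hp : p.Prime)
    (hF : Nat.card F = p ^ n) : Nat.card (⊥ : Subfield F) = p := by
  have : Fact p.Prime := ⟨hp⟩
  have : Finite F := Nat.finite_of_card_ne_zero (hF ▸ pow_ne_zero n hp.ne_zero)
  have := Fintype.ofFinite F
  have : CharP F p := charP_of_card_eq_prime_pow (Nat.card_eq_fintype_card.symm.trans hF)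
  exact Subfield.card_bot F p

theorem exists_subfield_natCard_sq_eq {F : Type*} [Field F] {p h : ℕ} (hp : p.Prime)
    (hF : Nat.card F = p ^ (2 * h)) (hh : 2 ≤ h) :
    ∃ K : Subfield F, Nat.card K ^ 2 = Nat.card F ∧ Nat.card (⊥ : Subfield K) = p ∧
      p < Nat.card K := by
  obtain ⟨K, hK⟩ := exists_subfield_natCard_eq hp hF (by omega : h ≠ 0) (dvd_mul_left h 2)
  refine ⟨K, by rw [hK, hF, ← pow_mul, mul_comm], natCard_bot_subfield hp hK, ?_⟩
  rw [hK]
  exact lt_self_pow₀ hp.one_lt hh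

theorem sqrt_natCard_eq {F : Type*} [Field F] {K : Subfield F} (h : Nat.card K ^ 2 = Nat.card F) :
    √(Nat.card F : ℝ) = Nat.card K := by
  rw [← h, Nat.cast_pow, Real.sqrt_sq (Nat.cast_nonneg _)]

variable {F : Type*} [Field F] [Finite F]

theorem natCard_subfield_lt_iff {K : Subfield F} : Nat.card K < Nat.card F ↔ K ≠ ⊤ := by
  constructor
  · rintro h rfl
    exact h.ne (Nat.card_congr Subfield.topEquiv.toEquiv)
  · intro hK
    rw [← Set.ncard_univ F]
    exact Set.ncard_lt_ncard (Set.ssubset_univ_iff.2 fun h => hK (SetLike.coe_injective h))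

theorem exists_natCard_eq_largestProperSubfieldOrder (h : ∃ K : Subfield F, K ≠ ⊤) :
    ∃ K : Subfield F, K ≠ ⊤ ∧ Nat.card K = largestProperSubfieldOrder F := by
  obtain ⟨K, hK⟩ := h
  refine Nat.sSup_mem (s := {n | ∃ L : Subfield F, L ≠ ⊤ ∧ Nat.card L = n}) ⟨_, K, hK, rfl⟩
    ⟨Nat.card F, ?_⟩
  rintro _ ⟨L, hL, rfl⟩
  exact (natCard_subfield_lt_iff.2 hL).le

theorem finrank_eq_two_of_natCard_sq_eq {K : Subfield F} (h : Nat.card K ^ 2 = Nat.card F) :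
    Module.finrank K F = 2 := by
  rw [Module.natCard_eq_pow_finrank (K := K) (V := F)] at h
  exact (Nat.pow_right_injective (Finite.one_lt_card (α := K)) h).symm

variable {K : Subfield F} {k : Subfield K}

theorem exists_isSaturating_frobenius (hK : Nat.card K ^ 2 = Nat.card F)
    (hk : Nat.card k < Nat.card K) :
    ∃ B : Set (ℙ K (Fin 3 → K)), IsDoubleBlocking B ∧ IsSaturating 1 (subplaneIncl K '' B) ∧
      ((subplaneIncl K '' B).ncard : ℝ) =
        2 * √(Nat.card F : ℝ) + 2 * ((√(Nat.card F : ℝ) - 1) / ((Nat.card k : ℝ) - 1)) := by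
  obtain ⟨B, hB, hcard⟩ := exists_isDoubleBlocking_ncard_eq_frobenius hk
  refine ⟨B, hB, hB.isSaturating_image (finrank_eq_two_of_natCard_sq_eq hK), ?_⟩
  rw [Set.ncard_image_of_injective _ (subplaneIncl_injective K), hcard, sqrt_natCard_eq hK]

theorem exists_isSaturating_trace (hK : Nat.card K ^ 2 = Nat.card F)
    (hk : Nat.card k < Nat.card K) :
    ∃ B : Set (ℙ K (Fin 3 → K)), IsDoubleBlocking B ∧ IsSaturating 1 (subplaneIncl K '' B) ∧
      ((subplaneIncl K '' B).ncard : ℝ) =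
        2 * √(Nat.card F : ℝ) + 2 * (√(Nat.card F : ℝ) / (Nat.card k : ℝ)) + 2 := by
  obtain ⟨B, hB, hcard⟩ := exists_isDoubleBlocking_ncard_eq_trace hk
  refine ⟨B, hB, hB.isSaturating_image (finrank_eq_two_of_natCard_sq_eq hK), ?_⟩
  rw [Set.ncard_image_of_injective _ (subplaneIncl_injective K), hcard, sqrt_natCard_eq hK]

end Subfield

theorem two_mul_sqrt_add_geometric_eq {s : ℝ} (hs : 1 < s) :
    2 * √(s ^ 6) + 2 * ((√(s ^ 6) - 1) / (s - 1)) =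
      2 * √(s ^ 6) + 2 * (s ^ 6) ^ (1 / 3 : ℝ) + 2 * (s ^ 6) ^ (1 / 6 : ℝ) + 2 := by
  have hs0 : 0 ≤ s := by linarith
  have hsqrt : √(s ^ 6) = s ^ 3 := by
    rw [show s ^ 6 = (s ^ 3) ^ 2 by ring, Real.sqrt_sq (pow_nonneg hs0 3)]
  have hcbrt : (s ^ 6) ^ (1 / 3 : ℝ) = s ^ 2 := by
    rw [show s ^ 6 = (s ^ 2) ^ 3 by ring, one_div]
    exact Real.pow_rpow_inv_natCast (pow_nonneg hs0 2) three_ne_zero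
  have hsixth : (s ^ 6) ^ (1 / 6 : ℝ) = s := by
    rw [one_div]
    exact Real.pow_rpow_inv_natCast hs0 (by norm_num)
  have hgeom : (s ^ 3 - 1) / (s - 1) = s ^ 2 + s + 1 := by
    rw [div_eq_iff (sub_ne_zero.2 hs.ne')]
    ring
  rw [hsqrt, hcbrt, hsixth, hgeom]
  ring

theorem mainTheorem9_general {F : Type*} [Field F] (p q : ℕ) (hp : p.Prime)
    (hF : Nat.card F = q) :
    (∀ h : ℕ, q = p ^ (6 * h) →
      ∃ K : Subfield F, Nat.card K ^ 2 = q ∧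
        ∃ B : Set (ℙ K (Fin 3 → K)), IsDoubleBlocking B ∧
          IsSaturating 1 (subplaneIncl K '' B) ∧
          ((subplaneIncl K '' B).ncard : ℝ) =
            2 * √(q : ℝ) + 2 * (q : ℝ) ^ (1 / 3 : ℝ) + 2 * (q : ℝ) ^ (1 / 6 : ℝ) + 2) ∧
    (∀ h : ℕ, q = p ^ (2 * h) → 2 ≤ h →
      ∃ K : Subfield F, Nat.card K ^ 2 = q ∧
        ∃ B : Set (ℙ K (Fin 3 → K)), IsDoubleBlocking B ∧
          IsSaturating 1 (subplaneIncl K '' B) ∧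
          ((subplaneIncl K '' B).ncard : ℝ) =
            2 * √(q : ℝ) + 2 * ((√(q : ℝ) - 1) / ((largestProperSubfieldOrder K : ℝ) - 1))) ∧
    (∀ h : ℕ, q = p ^ (2 * h) → 2 ≤ h →
      ∃ K : Subfield F, Nat.card K ^ 2 = q ∧
        ∃ B : Set (ℙ K (Fin 3 → K)), IsDoubleBlocking B ∧
          IsSaturating 1 (subplaneIncl K '' B) ∧
          ((subplaneIncl K '' B).ncard : ℝ) =
            2 * √(q : ℝ) + 2 * (√(q : ℝ) / (p : ℝ)) + 2) := by
  subst hF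
  refine ⟨fun h hq => ?_, fun h hq hh => ?_, fun h hq hh => ?_⟩ <;>
    have : Finite F := Nat.finite_of_card_ne_zero (hq ▸ pow_ne_zero _ hp.ne_zero)
  · have hh : h ≠ 0 := by
      rintro rfl
      exact Finite.one_lt_card.ne' hq
    have hs : 1 < p ^ h := Nat.one_lt_pow hh hp.one_lt
    obtain ⟨K, k, hK, hk⟩ := exists_subfield_tower_natCard_eq hp hq hh
    have hF : Nat.card F = (p ^ h) ^ 6 := by rw [hq, ← pow_mul, mul_comm]
    have hK2 : Nat.card K ^ 2 = Nat.card F := by rw [hK, hF, ← pow_mul]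
    obtain ⟨B, hB, hsat, hcard⟩ := exists_isSaturating_frobenius (k := k) hK2
      (by rw [hk, hK]; exact lt_self_pow₀ hs (by norm_num))
    refine ⟨K, hK2, B, hB, hsat, hcard.trans ?_⟩
    rw [hk, hF, Nat.cast_pow _ 6]
    exact two_mul_sqrt_add_geometric_eq (mod_cast hs)
  · obtain ⟨K, hK, hbot, hlt⟩ := exists_subfield_natCard_sq_eq hp hq hh
    obtain ⟨k, hk, hcard⟩ := exists_natCard_eq_largestProperSubfieldOrder (F := K)
      ⟨⊥, natCard_subfield_lt_iff.1 (hbot.trans_lt hlt)⟩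
    exact ⟨K, hK, hcard ▸ exists_isSaturating_frobenius hK (natCard_subfield_lt_iff.2 hk)⟩
  · obtain ⟨K, hK, hbot, hlt⟩ := exists_subfield_natCard_sq_eq hp hq hh
    have hsat := exists_isSaturating_trace (k := ⊥) hK (hbot.trans_lt hlt)
    rw [hbot] at hsat
    exact ⟨K, hK, hsat⟩

theorem mainTheorem9 {F : Type*} [Field F] (p q : ℕ) (hp : p.Prime) (hF : Nat.card F = q) :
    (∀ h : ℕ, q = p ^ (6 * h) → p ^ h ≡ 2 [MOD 7] →
      ∃ K : Subfield F, Nat.card K ^ 2 = q ∧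
        ∃ B : Set (ℙ K (Fin 3 → K)), IsDoubleBlocking B ∧
          IsSaturating 1 (subplaneIncl K '' B) ∧
          ((subplaneIncl K '' B).ncard : ℝ) =
            2 * √(q : ℝ) + 2 * (q : ℝ) ^ (1 / 3 : ℝ) + 2 * (q : ℝ) ^ (1 / 6 : ℝ) + 2) ∧
    (∀ h : ℕ, q = p ^ (2 * h) → 2 ≤ h → 3 ≤ p →
      ∃ K : Subfield F, Nat.card K ^ 2 = q ∧
        ∃ B : Set (ℙ K (Fin 3 → K)), IsDoubleBlocking B ∧
          IsSaturating 1 (subplaneIncl K '' B) ∧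
          ((subplaneIncl K '' B).ncard : ℝ) =
            2 * √(q : ℝ) + 2 * ((√(q : ℝ) - 1) / ((largestProperSubfieldOrder K : ℝ) - 1))) ∧
    (∀ h : ℕ, q = p ^ (2 * h) → 2 ≤ h → 7 ≤ p →
      ∃ K : Subfield F, Nat.card K ^ 2 = q ∧
        ∃ B : Set (ℙ K (Fin 3 → K)), IsDoubleBlocking B ∧
          IsSaturating 1 (subplaneIncl K '' B) ∧
          ((subplaneIncl K '' B).ncard : ℝ) =
            2 * √(q : ℝ) + 2 * (√(q : ℝ) / (p : ℝ)) + 2) :=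
  have ⟨hiv, hv, hvi⟩ := mainTheorem9_general p q hp hF
  ⟨fun h hq _ => hiv h hq, fun h hq hh _ => hv h hq hh, fun h hq hh _ => hvi h hq hh⟩
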